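/- Lemma 2.6 (periodic Toda functional identities). Let $N\ge 1$, let $a_+,a_->0$, $\rho\in\mathbb C$ and $\delta\in\{+,-\}$, and put $$e_\delta(z)=\exp(\pi z/a_\delta),\qquad t_\delta(z)=1-e_\delta(2z+2\rho),\qquad z\in\mathbb C.$$ Let $x_1,\dots,x_N,y_1,\dots,y_N\in\mathbb C$ be such that the denominators $t_\delta(y_m-x_m-\rho)$, $m=1,\dots,N$, are nonzero, and read all indices modulo $N$ (so that $x_{N+1}=x_1$, $y_0=y_N$, and $m\pm1\notin I$ is also understood modulo $N$). Then for every $k=1,\dots,N$, $$\sum_{\substack{I\subset\{1,\dots,N\}\\ |I|=k}}\ \prod_{\substack{m\in I\\ m+1\notin I}}t_\delta(x_{m+1}-x_m)\prod_{m\in I}\frac{t_\delta(x_m-y_{m-1})}{t_\delta(y_m-x_m-\rho)} =\sum_{\substack{I\subset\{1,\dots,N\}\\ |I|=k}}\ \prod_{\substack{m\in I\\ m-1\notin I}}t_\delta(y_m-y_{m-1})\prod_{m\in I}\frac{t_\delta(x_{m+1}-y_m)}{t_\delta(y_m-x_m-\rho)}.$$ -/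

import Mathlib

/-- The exponential `e_δ(z) = exp(π z / a_δ)`. The two signs `δ = +, -` are the elements
`1, -1` of `ℤˣ`, and `a δ` is the parameter `a_δ`. -/
noncomputable def eDelta (a : ℤˣ → ℝ) (δ : ℤˣ) (z : ℂ) : ℂ :=
  Complex.exp ((Real.pi : ℂ) * z / (a δ : ℂ))

/-- The Toda building block `t_δ(z) = 1 - e_δ(2 z + 2 ρ)` with coupling parameter `ρ`. -/
noncomputable def tDelta (a : ℤˣ → ℝ) (ρ : ℂ) (δ : ℤˣ) (z : ℂ) : ℂ :=
  1 - eDelta a δ (2 * z + 2 * ρ)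

/-! Both sides are coefficients of `X ^ k` in traces of cyclic products of 2×2 transfer matrices
over `K[X]`: a subset `I` is a closed path of 0/1 states, and `X` counts its elements. With e =
e_δ(2(y_m - x_m)) and g = e_δ(2(x_m - y_{m-1}) + 2ρ), the two families of matrices satisfy A_m
H_{m+1} = H_m B_m (`transfer_intertwine`), where H_m depends only on g_m. The product around the
cycle therefore telescopes, and the traces agree once some H_j has nonzero determinant. -/

/-- Entries of a product of matrices as sums over paths of intermediate indices. -/
theorem List.prod_ofFn_matrix_apply {ι R : Type*} [Fintype ι] [DecidableEq ι] [CommRing R] :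
    ∀ (n : ℕ) (A : Fin (n + 1) → Matrix ι ι R) (a b : ι),
      (List.ofFn A).prod a b = ∑ s : Fin n → ι,
        ∏ i, A i ((Fin.cons a s : Fin (n + 1) → ι) i) ((Fin.snoc s b : Fin (n + 1) → ι) i)
  | 0, A, a, b => by simp [Fin.snoc]
  | n + 1, A, a, b => by
    rw [List.ofFn_succ, List.prod_cons, Matrix.mul_apply,
      ← (Fin.consEquiv fun _ : Fin (n + 1) => ι).sum_comp, Fintype.sum_prod_type]
    refine Finset.sum_congr rfl fun c _ => ?_
    rw [List.prod_ofFn_matrix_apply n, Finset.mul_sum]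
    refine Finset.sum_congr rfl fun s _ => ?_
    conv_rhs => rw [Fin.prod_univ_succ]
    simp [Fin.consEquiv, ← Fin.cons_snoc_eq_snoc_cons]

/-- The sum over closed paths of length `N` of the product of the matrix entries met. -/
def cyclicSum {ι R : Type*} [Fintype ι] [CommRing R] {N : ℕ} [NeZero N]
    (A : Fin N → Matrix ι ι R) : R :=
  ∑ s : Fin N → ι, ∏ m, A m (s m) (s (m + 1))

theorem Matrix.trace_prod_ofFn {ι R : Type*} [Fintype ι] [DecidableEq ι] [CommRing R] {n : ℕ}
    (A : Fin (n + 1) → Matrix ι ι R) : (List.ofFn A).prod.trace = cyclicSum A := by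
  rw [cyclicSum, ← (Fin.consEquiv fun _ : Fin (n + 1) => ι).sum_comp, Fintype.sum_prod_type,
    Matrix.trace]
  refine Finset.sum_congr rfl fun a _ => ?_
  rw [Matrix.diag_apply, List.prod_ofFn_matrix_apply]
  refine Finset.sum_congr rfl fun s _ => Finset.prod_congr rfl fun i _ => ?_
  congr 1
  induction i using Fin.lastCases with
  | last => simp [Fin.consEquiv]
  | cast i => simp [Fin.consEquiv]

theorem sum_functions_shift {ι R G : Type*} [Fintype ι] [AddCommMonoid R] [AddGroup G]
    [Fintype G] [DecidableEq G] (F : (G → ι) → R) (j : G) :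
    ∑ s : G → ι, F (fun m => s (m + j)) = ∑ s, F s :=
  ((Equiv.addRight j).symm.arrowCongr (Equiv.refl ι)).sum_comp F

theorem cyclicSum_shift {ι R : Type*} [Fintype ι] [CommRing R] {N : ℕ} [NeZero N]
    (A : Fin N → Matrix ι ι R) (j : Fin N) : cyclicSum (fun m => A (m + j)) = cyclicSum A := by
  unfold cyclicSum
  rw [← sum_functions_shift _ j]
  refine Finset.sum_congr rfl fun s _ => ?_
  rw [← Equiv.prod_comp (Equiv.addRight j) fun m => A m (s m) (s (m + 1))]
  refine Finset.prod_congr rfl fun m _ => ?_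
  simp only [Equiv.coe_addRight, add_right_comm m j 1]

theorem cyclicSum_eq_sum_sub_one {ι R : Type*} [Fintype ι] [CommRing R] {N : ℕ} [NeZero N]
    (A : Fin N → Matrix ι ι R) : cyclicSum A = ∑ s : Fin N → ι, ∏ m, A m (s (m - 1)) (s m) := by
  rw [← sum_functions_shift _ 1, cyclicSum]
  simp

theorem List.prod_ofFn_mul_of_intertwine {M : Type*} [Monoid M] :
    ∀ (n : ℕ) (A B : Fin n → M) (H : Fin (n + 1) → M),
      (∀ i, A i * H i.succ = H i.castSucc * B i) →
      (List.ofFn A).prod * H (Fin.last n) = H 0 * (List.ofFn B).prod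
  | 0, A, B, H, _ => by simp
  | n + 1, A, B, H, h => by
    have ih := List.prod_ofFn_mul_of_intertwine n (fun i => A i.succ) (fun i => B i.succ)
      (fun i => H i.succ) (fun i => h i.succ)
    have h0 := h 0
    rw [Fin.succ_last] at ih
    rw [List.ofFn_succ, List.ofFn_succ, List.prod_cons, List.prod_cons, mul_assoc, ih,
      ← mul_assoc, h0, mul_assoc]
    rfl

/-- The adjugate replaces the inverse: over `K[X]` a nonzero determinant need not be a unit, but it
can be cancelled. -/
theorem Matrix.trace_eq_of_mul_eq_mul {ι R : Type*} [Fintype ι] [DecidableEq ι] [CommRing R]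
    [IsDomain R] {P Q H : Matrix ι ι R} (hH : H.det ≠ 0) (h : P * H = H * Q) :
    P.trace = Q.trace := by
  refine mul_left_cancel₀ hH ?_
  have h1 : (P * H * H.adjugate).trace = H.det * P.trace := by
    rw [mul_assoc, mul_adjugate]; simp
  have h2 : (H * Q * H.adjugate).trace = H.det * Q.trace := by
    rw [Matrix.trace_mul_comm, ← mul_assoc, adjugate_mul]; simp
  rw [← h1, h, h2]

/-- Cyclic sums of two families of matrices agree if the families are related by a cyclic gauge
transformation that is nonsingular at one site. -/
theorem cyclicSum_eq_of_intertwine {ι R : Type*} [Fintype ι] [DecidableEq ι] [CommRing R]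
    [IsDomain R] {N : ℕ} [NeZero N] {A B H : Fin N → Matrix ι ι R}
    (h : ∀ m, A m * H (m + 1) = H m * B m) {j : Fin N} (hj : (H j).det ≠ 0) :
    cyclicSum A = cyclicSum B := by
  obtain ⟨n, rfl⟩ := Nat.exists_eq_succ_of_ne_zero (NeZero.ne N)
  rw [← cyclicSum_shift A j, ← cyclicSum_shift B j, ← Matrix.trace_prod_ofFn,
    ← Matrix.trace_prod_ofFn]
  refine Matrix.trace_eq_of_mul_eq_mul hj ?_
  -- The cycle is cut open at `j`, so `H j` occurs at both ends of the chain.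
  have key := List.prod_ofFn_mul_of_intertwine (n + 1) (fun m => A (m + j)) (fun m => B (m + j))
    (Fin.snoc (fun m => H (m + j)) (H j) : Fin (n + 2) → Matrix ι ι R) ?_
  · have h0 : (Fin.snoc (fun m => H (m + j)) (H j) : Fin (n + 2) → Matrix ι ι R) 0 = H j := by
      rw [← Fin.castSucc_zero, Fin.snoc_castSucc, zero_add]
    rwa [h0, Fin.snoc_last] at key
  · intro i
    have hs : (Fin.snoc (fun m => H (m + j)) (H j) : Fin (n + 2) → Matrix ι ι R) i.succ
        = H (i + j + 1) := by
      induction i using Fin.lastCases with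
      | last => rw [Fin.succ_last, Fin.snoc_last, add_right_comm, Fin.last_add_one, zero_add]
      | cast i =>
        rw [Fin.succ_castSucc, Fin.snoc_castSucc, ← Fin.coeSucc_eq_succ, add_right_comm]
    rw [hs, Fin.snoc_castSucc, h]

open Finset in
theorem sum_fin_two_functions {α R : Type*} [Fintype α] [DecidableEq α] [AddCommMonoid R]
    (F : (α → Fin 2) → R) :
    ∑ s, F s = ∑ I : Finset α, F fun m => if m ∈ I then 1 else 0 := by
  refine Finset.sum_nbij' (fun s => ({m | s m = 1} : Finset α))
    (fun I m => if m ∈ I then 1 else 0) (by simp) (by simp) ?_ ?_ ?_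
  · intro s _
    ext m
    have := (s m).isLt
    simp only [mem_filter, mem_univ, true_and]
    split_ifs with h
    · simp [h]
    · have : (s m : ℕ) ≠ 1 := fun h' => h (Fin.ext h')
      simp; omega
  · intro I _
    ext m
    simp
  · intro s _
    congr 1
    ext m
    simp only [mem_filter, mem_univ, true_and]
    split_ifs with h
    · simp [h]
    · have : (s m : ℕ) ≠ 1 := fun h' => h (Fin.ext h')
      simp; omega

open Finset Polynomial in
theorem coeff_sum_C_mul_X_pow_card {α K : Type*} [Fintype α] [DecidableEq α] [CommRing K]
    (f : Finset α → K) (k : ℕ) :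
    (∑ I : Finset α, C (f I) * X ^ #I).coeff k = ∑ I ∈ powersetCard k univ, f I := by
  simp only [finsetSum_coeff, coeff_C_mul_X_pow]
  rw [← Finset.sum_filter]
  refine Finset.sum_congr ?_ fun _ _ => rfl
  ext I
  simp [mem_powersetCard, eq_comm]

-- The row records whether m ∈ I, the column whether m + 1 ∈ I.
open Finset Polynomial in
theorem cyclicSum_successor {K : Type*} [CommRing K] {N : ℕ} [NeZero N] (p v : Fin N → K) :
    cyclicSum (fun m => !![1, 1; X * C (v m * p m), X * C (v m)]) =
      ∑ I : Finset (Fin N), C ((∏ m ∈ I with m + 1 ∉ I, p m) * ∏ m ∈ I, v m) * X ^ #I := by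
  rw [cyclicSum, sum_fin_two_functions]
  refine Finset.sum_congr rfl fun I _ => ?_
  rw [← Finset.prod_const, C_mul, map_prod, map_prod, Finset.prod_filter, mul_assoc,
    ← Finset.prod_mul_distrib, ← Finset.prod_mul_distrib, ← Finset.prod_subset (subset_univ I)]
  · refine Finset.prod_congr rfl fun m hm => ?_
    by_cases h : m + 1 ∈ I
    · simp [hm, h]
    · simp [hm, h]
      ring
  · intro m _ hm
    by_cases h : m + 1 ∈ I <;> simp [hm, h]

-- Here the row records whether m - 1 ∈ I and the column whether m ∈ I.
open Finset Polynomial in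
theorem cyclicSum_predecessor {K : Type*} [CommRing K] {N : ℕ} [NeZero N] (q w : Fin N → K) :
    cyclicSum (fun m => !![1, X * C (w m * q m); 1, X * C (w m)]) =
      ∑ I : Finset (Fin N), C ((∏ m ∈ I with m - 1 ∉ I, q m) * ∏ m ∈ I, w m) * X ^ #I := by
  rw [cyclicSum_eq_sum_sub_one, sum_fin_two_functions]
  refine Finset.sum_congr rfl fun I _ => ?_
  rw [← Finset.prod_const, C_mul, map_prod, map_prod, Finset.prod_filter, mul_assoc,
    ← Finset.prod_mul_distrib, ← Finset.prod_mul_distrib, ← Finset.prod_subset (subset_univ I)]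
  · refine Finset.prod_congr rfl fun m hm => ?_
    by_cases h : m - 1 ∈ I
    · simp [hm, h]
    · simp [hm, h]
      ring
  · intro m _ hm
    by_cases h : m - 1 ∈ I <;> simp [hm, h]

/-- The local gauge transformation between the two families of transfer matrices. -/
theorem transfer_intertwine {R : Type*} [CommRing R] {z e g g' b b' v w : R}
    (hb : b * g = 1) (hb' : b' * g' = 1) (hv : v * (1 - e) = 1 - g) (hw : w * (1 - e) = 1 - g') :
    !![1, 1; z * (v * (1 - e * g')), z * v] *
        !![b', 1 - b'; 1 - b', z * (1 - g') - (1 - b')] =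
      !![b, 1 - b; 1 - b, z * (1 - g) - (1 - b)] * !![1, z * (w * (1 - e * g)); 1, z * w] := by
  ext i j
  fin_cases i <;> fin_cases j <;> simp [Matrix.mul_apply, Fin.sum_univ_two]
  · linear_combination z * w * e * hb - z * hw
  · linear_combination -z * v * e * hb' + z * hv
  · linear_combination z * v * e * hb' - z * w * e * hb - z * (z + e) * v * hw + z * (z + e) * w * hv

open Finset Polynomial in
theorem periodic_toda_identity {K : Type*} [Field K] {N : ℕ} [NeZero N] (e g : Fin N → K)
    (hg : ∀ m, g m ≠ 0) (he : ∀ m, 1 - e m ≠ 0) {k : ℕ} (hk : 1 ≤ k) :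
    ∑ I ∈ powersetCard k (univ : Finset (Fin N)),
        (∏ m ∈ I with m + 1 ∉ I, (1 - e m * g (m + 1))) * ∏ m ∈ I, (1 - g m) / (1 - e m) =
      ∑ I ∈ powersetCard k (univ : Finset (Fin N)),
        (∏ m ∈ I with m - 1 ∉ I, (1 - e m * g m)) *
          ∏ m ∈ I, (1 - g (m + 1)) / (1 - e m) := by
  -- If every `g m` is 1, all the gauge matrices are singular, but every summand contains a
  -- vanishing factor 1 - g since k ≥ 1.
  by_cases hall : ∀ m, g m = 1
  · have hne : ∀ I ∈ powersetCard k (univ : Finset (Fin N)), #I ≠ 0 := fun I hI => by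
      rw [(mem_powersetCard.1 hI).2]; omega
    rw [Finset.sum_eq_zero, Finset.sum_eq_zero] <;>
    · intro I hI
      simp [hall, hne I hI]
  · push Not at hall
    obtain ⟨j, hj⟩ := hall
    rw [← coeff_sum_C_mul_X_pow_card, ← coeff_sum_C_mul_X_pow_card, ← cyclicSum_successor,
      ← cyclicSum_predecessor]
    congr 1
    refine cyclicSum_eq_of_intertwine (j := j)
      (H := fun m => !![C (g m)⁻¹, 1 - C (g m)⁻¹; 1 - C (g m)⁻¹,
        X * (1 - C (g m)) - (1 - C (g m)⁻¹)]) (fun m => ?_) ?_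
    · have hb : ∀ m, (C (g m)⁻¹ * C (g m) : K[X]) = 1 := fun m => by
        rw [← C_mul, inv_mul_cancel₀ (hg m), C_1]
      have hd : ∀ a : K, (C (a / (1 - e m)) * (1 - C (e m)) : K[X]) = C a := fun a => by
        rw [← C_1, ← C_sub, ← C_mul, div_mul_cancel₀ _ (he m)]
      simpa only [C_mul, C_sub, C_1] using transfer_intertwine (z := (X : K[X])) (hb m)
        (hb (m + 1)) ((hd (1 - g m)).trans (by simp)) ((hd (1 - g (m + 1))).trans (by simp))
    · intro h0
      -- At X = 0 the determinant is `(g j)⁻¹ - 1`.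
      have h1 := congrArg (Polynomial.eval 0) h0
      simp [Matrix.det_fin_two] at h1
      apply hj
      have : (g j)⁻¹ = 1 := by linear_combination h1
      exact inv_eq_one.1 this

theorem eDelta_add (a : ℤˣ → ℝ) (δ : ℤˣ) (z w : ℂ) :
    eDelta a δ (z + w) = eDelta a δ z * eDelta a δ w := by
  simp only [eDelta, ← Complex.exp_add]
  ring_nf

/-- Periodic Toda functional identities. The particle indices `1, …, N` are the elements of `Fin N`,
on which `m + 1` and `m - 1` are the cyclic successor and predecessor. -/
theorem lemma2p6 (N : ℕ) [NeZero N] (a : ℤˣ → ℝ) (ha : ∀ δ, 0 < a δ) (ρ : ℂ) (δ : ℤˣ)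
    (x y : Fin N → ℂ) (hxy : ∀ m, tDelta a ρ δ (y m - x m - ρ) ≠ 0)
    (k : ℕ) (hk : 1 ≤ k) (hkN : k ≤ N) :
    ∑ I ∈ Finset.powersetCard k (Finset.univ : Finset (Fin N)),
        (∏ m ∈ I with m + 1 ∉ I, tDelta a ρ δ (x (m + 1) - x m)) *
          ∏ m ∈ I, tDelta a ρ δ (x m - y (m - 1)) / tDelta a ρ δ (y m - x m - ρ) =
      ∑ I ∈ Finset.powersetCard k (Finset.univ : Finset (Fin N)),
        (∏ m ∈ I with m - 1 ∉ I, tDelta a ρ δ (y m - y (m - 1))) *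
          ∏ m ∈ I, tDelta a ρ δ (x (m + 1) - y m) / tDelta a ρ δ (y m - x m - ρ) := by
  have h := periodic_toda_identity (fun m => eDelta a δ (2 * (y m - x m)))
    (fun m => eDelta a δ (2 * (x m - y (m - 1)) + 2 * ρ)) (fun m => Complex.exp_ne_zero _)
    (fun m => by
      have := hxy m
      rw [tDelta] at this
      convert this using 3
      ring) hk
  have hp : ∀ m, eDelta a δ (2 * (x (m + 1) - x m) + 2 * ρ) =
      eDelta a δ (2 * (y m - x m)) * eDelta a δ (2 * (x (m + 1) - y m) + 2 * ρ) := fun m => by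
    rw [← eDelta_add]; congr 1; ring
  have hq : ∀ m, eDelta a δ (2 * (y m - y (m - 1)) + 2 * ρ) =
      eDelta a δ (2 * (y m - x m)) * eDelta a δ (2 * (x m - y (m - 1)) + 2 * ρ) := fun m => by
    rw [← eDelta_add]; congr 1; ring
  have hd : ∀ m, eDelta a δ (2 * (y m - x m - ρ) + 2 * ρ) = eDelta a δ (2 * (y m - x m)) :=
    fun m => by congr 1; ring
  simpa only [tDelta, hp, hq, hd, add_sub_cancel_right] using h
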